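/- Theorem (Grassmann scheme). Let $\mathbb{F}$ be a field and let $d,m\in\mathbb{N}=\{0,1,2,\dots\}$. For $I=(i_1<\dots<i_d)$ with $1\le i_j\le m$ and a $d\times m$ matrix $M$, let $M_I$ be the $d\times d$ submatrix of $M$ formed by the columns in $I$. Let $x=(x_{ij})$ be the $d\times m$ matrix of variables, let $R(I)=\mathbb{F}[x_{ij}]/K(I)$, where $K(I)$ is generated by the entries of $x_I-1_d$, and let $\mathcal{W}(I)=\mathrm{Spec}\,R(I)$. For two index sequences $I,J$ let $R(I,J)=R(I)[\det(x_J)^{-1}]$, let $\mathcal{W}(I,J)=\mathrm{Spec}\,R(I,J)$, an open subscheme of $\mathcal{W}(I)$, and let $\varphi_{JI}:\mathcal{W}(I,J)\to\mathcal{W}(J,I)$ be the morphism of $\mathbb{F}$-schemes given on points by $M\mapsto M_J^{-1}M$. Then there is an $\mathbb{F}$-scheme $\mathcal{G}_{\mathbb{F}}(d,m)$ with $\mathbb{F}$-morphisms $\psi_I:\mathcal{W}(I)\to\mathcal{G}_{\mathbb{F}}(d,m)$ which is the gluing of the $\mathcal{W}(I)$ along the $\varphi_{JI}$, that is: each $\psi_I$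 is an open immersion; $\psi_J\circ\varphi_{JI}=\psi_I$ on $\mathcal{W}(I,J)$; the images $\psi_I(\mathcal{W}(I))$ cover $\mathcal{G}_{\mathbb{F}}(d,m)$; and $\psi_I(\mathcal{W}(I))\cap\psi_J(\mathcal{W}(J))=\psi_I(\mathcal{W}(I,J))=\psi_J(\mathcal{W}(J,I))$ for all $I,J$. Moreover: 1. $\mathcal{G}_{\mathbb{F}}(d,m)$ is a projective $\mathbb{F}$-scheme, i.e. it admits a closed immersion of $\mathbb{F}$-schemes into $\mathbb{P}^n_{\mathbb{F}}=\mathrm{Proj}(\mathbb{F}[x_0,\dots,x_n])$ for some $n\in\mathbb{N}$. 2. There is a bijection from the set of $\mathbb{F}$-points $\mathcal{G}_{\mathbb{F}}(d,m)(\mathbb{F})$ (the $\mathbb{F}$-morphisms $\mathrm{Spec}\,\mathbb{F}\to\mathcal{G}_{\mathbb{F}}(d,m)$) onto the set of $d$-dimensional $\mathbb{F}$-linear subspaces of $\mathbb{F}^m$, which for every $I$ sends the image under $\psi_I$ of the $\mathbb{F}$-point of $\mathcal{W}(I)$ given by a matrix $M\in\mathbb{F}^{d\times m}$ with $M_I=1_d$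 to the row space of $M$. If $d>m$, then there are no charts and $\mathcal{G}_{\mathbb{F}}(d,m)=\emptyset$. -/

import Mathlib

open CategoryTheory AlgebraicGeometry

universe u

/-! ### Schemes over a field -/

/-- `Spec F` as an `F`-scheme. -/
noncomputable abbrev specBase (F : Type u) [Field F] : Over (Spec (CommRingCat.of F)) :=
  Over.mk (𝟙 (Spec (CommRingCat.of F)))

/-- The affine `F`-scheme `Spec A` of an `F`-algebra `A`. -/
noncomputable def specOver (F : Type u) [Field F] (A : Type u) [CommRing A] [Algebra F A] :
    Over (Spec (CommRingCat.of F)) :=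
  Over.mk (Spec.map (CommRingCat.ofHom (algebraMap F A)))

/-- The morphism of `F`-schemes `Spec B ⟶ Spec A` given by an `F`-algebra homomorphism `A → B`. -/
noncomputable def specOverMap {F : Type u} [Field F] {A B : Type u} [CommRing A] [CommRing B]
    [Algebra F A] [Algebra F B] (f : A →ₐ[F] B) : specOver F B ⟶ specOver F A :=
  Over.homMk (Spec.map (CommRingCat.ofHom f.toRingHom)) (by
    simp only [specOver, Over.mk_hom, ← Spec.map_comp, ← CommRingCat.ofHom_comp]
    congr 2
    exact f.comp_algebraMap)

/-- The set `X(F)` of `F`-points of an `F`-scheme `X`: the `F`-morphisms `Spec F ⟶ X`. -/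
abbrev FPoints {F : Type u} [Field F] (X : Over (Spec (CommRingCat.of F))) : Type u :=
  specBase F ⟶ X

/-- The grading of a polynomial ring by total degree. -/
noncomputable instance homogeneousGrading (F : Type u) [Field F] (n : ℕ) :
    GradedAlgebra (MvPolynomial.homogeneousSubmodule (Fin (n + 1)) F) :=
  MvPolynomial.gradedAlgebra

/-- Projective space `ℙⁿ_F = Proj F[x₀, …, xₙ]` as an `F`-scheme. -/
noncomputable def projSpace (F : Type u) [Field F] (n : ℕ) : Over (Spec (CommRingCat.of F)) :=
  Over.mk (Proj.toSpecZero (MvPolynomial.homogeneousSubmodule (Fin (n + 1)) F) ≫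
    Spec.map (CommRingCat.ofHom
      (algebraMap F (MvPolynomial.homogeneousSubmodule (Fin (n + 1)) F 0))))

/-- An `F`-scheme is projective if it admits a closed immersion of `F`-schemes
into some `ℙⁿ_F`. -/
def IsProjectiveScheme {F : Type u} [Field F] (X : Over (Spec (CommRingCat.of F))) : Prop :=
  ∃ (n : ℕ) (i : X ⟶ projSpace F n), IsClosedImmersion i.left

/-! ### Gluing -/

/-- Let `U i` be `S`-schemes, `inc i j : V i j ⟶ U i` (the inclusion of an open subscheme) and
`t i j : V i j ⟶ V j i` the transition morphisms. Then `IsGluing inc t ψ` says that the `S`-scheme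
`X` together with `ψ i : U i ⟶ X` is the scheme obtained by gluing the `U i` along the `t i j`. -/
structure IsGluing {S : Scheme.{u}} {ι : Type*} {U : ι → Over S} {V : ι → ι → Over S}
    (inc : ∀ i j, V i j ⟶ U i) (t : ∀ i j, V i j ⟶ V j i) {X : Over S}
    (ψ : ∀ i, U i ⟶ X) : Prop where
  /-- each `ψ i` is an isomorphism onto an open subscheme of `X` -/
  isOpenImmersion : ∀ i, IsOpenImmersion (ψ i).left
  /-- on the overlaps the `ψ i` are compatible with the transition morphisms -/
  compat : ∀ i j, t i j ≫ inc j i ≫ ψ j = inc i j ≫ ψ i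
  /-- the images of the `ψ i` cover `X` -/
  cover : (⋃ i, Set.range (ψ i).left) = Set.univ
  /-- `ψ i (U i) ∩ ψ j (U j) = ψ i (V i j)` -/
  inter_left : ∀ i j, Set.range (ψ i).left ∩ Set.range (ψ j).left = Set.range (inc i j ≫ ψ i).left
  /-- `ψ i (U i) ∩ ψ j (U j) = ψ j (V j i)` -/
  inter_right : ∀ i j, Set.range (ψ i).left ∩ Set.range (ψ j).left = Set.range (inc j i ≫ ψ j).left

/-! ### The affine charts of the Grassmann scheme

`I : Fin d ↪o Fin m` is an increasing sequence `i₁ < ⋯ < i_d` of column indices, and for a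
`d × m` matrix `M` the square matrix `M_I` is `M.submatrix id I`. -/

namespace Grass

variable (F : Type u) [Field F] {d m : ℕ}

/-- The ideal `K(I)` of `F[x_ij]` generated by the entries of `(x_ij)_I - 1`. -/
noncomputable def chartIdeal (I : Fin d ↪o Fin m) : Ideal (MvPolynomial (Fin d × Fin m) F) :=
  Ideal.span (Set.range fun p : Fin d × Fin d =>
    ((Matrix.mvPolynomialX (Fin d) (Fin m) F).submatrix id I - 1) p.1 p.2)

/-- The coordinate ring `R(I) = F[x_ij] / K(I)`. -/
abbrev ChartRing (I : Fin d ↪o Fin m) : Type u :=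
  MvPolynomial (Fin d × Fin m) F ⧸ chartIdeal F I

/-- The universal matrix over `R(I)`, i.e. the image of `(x_ij)`. -/
noncomputable def chartMatrix (I : Fin d ↪o Fin m) : Matrix (Fin d) (Fin m) (ChartRing F I) :=
  (Matrix.mvPolynomialX (Fin d) (Fin m) F).map (Ideal.Quotient.mk (chartIdeal F I))

/-- The `F`-algebra homomorphism `R(I) → T` corresponding to a matrix `M` over `T`
with `M_I = 1`. -/
noncomputable def chartLift (I : Fin d ↪o Fin m) {T : Type u} [CommRing T] [Algebra F T]
    (M : Matrix (Fin d) (Fin m) T) (hM : M.submatrix id I = 1) : ChartRing F I →ₐ[F] T :=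
  Ideal.Quotient.liftₐ (chartIdeal F I) (MvPolynomial.aeval fun p : Fin d × Fin m => M p.1 p.2) (by
    have h : chartIdeal F I ≤ RingHom.ker
        (MvPolynomial.aeval fun p : Fin d × Fin m => M p.1 p.2) := by
      refine Ideal.span_le.2 ?_
      rintro _ ⟨⟨a, b⟩, rfl⟩
      have hab : M a (I b) = (1 : Matrix (Fin d) (Fin d) T) a b := by rw [← hM]; rfl
      by_cases e : a = b
      · subst e
        simp_all [RingHom.mem_ker]
      · simp_all [RingHom.mem_ker]
    exact fun a ha => h ha)

theorem chartLift_chartMatrix (I : Fin d ↪o Fin m) {T : Type u} [CommRing T] [Algebra F T]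
    (M : Matrix (Fin d) (Fin m) T) (hM : M.submatrix id I = 1) :
    (chartMatrix F I).map (chartLift F I M hM) = M := by
  ext a b
  simp only [chartMatrix, Matrix.map_apply, Matrix.mvPolynomialX_apply, chartLift]
  exact MvPolynomial.aeval_X _ _

/-- `R(I,J) = R(I)[det((x_ij)_J)⁻¹]`. -/
abbrev OverlapRing (I J : Fin d ↪o Fin m) : Type u :=
  Localization.Away ((chartMatrix F I).submatrix id J).det

/-- The universal matrix over `R(I,J)`, i.e. the image of `(x_ij)`. -/
noncomputable def overlapMatrix (I J : Fin d ↪o Fin m) :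
    Matrix (Fin d) (Fin m) (OverlapRing F I J) :=
  (chartMatrix F I).map (algebraMap (ChartRing F I) (OverlapRing F I J))

theorem chartMatrix_submatrix (I : Fin d ↪o Fin m) : (chartMatrix F I).submatrix id I = 1 := by
  ext a b
  have h : Ideal.Quotient.mk (chartIdeal F I)
      (((Matrix.mvPolynomialX (Fin d) (Fin m) F).submatrix id I - 1) a b) = 0 :=
    Ideal.Quotient.eq_zero_iff_mem.2 (Ideal.subset_span ⟨(a, b), rfl⟩)
  rw [Matrix.sub_apply, map_sub, sub_eq_zero] at h
  refine Eq.trans h ?_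
  by_cases e : a = b
  · subst e; simp
  · simp [e]

theorem overlapMatrix_submatrix (I J : Fin d ↪o Fin m) :
    (overlapMatrix F I J).submatrix id I = 1 := by
  have h := congrArg (fun A => Matrix.map A (algebraMap (ChartRing F I) (OverlapRing F I J)))
    (chartMatrix_submatrix F I)
  simp only [Matrix.map_one _ (map_zero _) (map_one _)] at h
  exact h

theorem isUnit_det_overlapMatrix (I J : Fin d ↪o Fin m) :
    IsUnit ((overlapMatrix F I J).submatrix id J).det := by
  have h := IsLocalization.Away.algebraMap_isUnit (S := OverlapRing F I J)
    ((chartMatrix F I).submatrix id J).det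
  rw [RingHom.map_det] at h
  exact h

/-- The matrix `x_J⁻¹ x` over `R(I,J)`. -/
noncomputable def transMatrix (I J : Fin d ↪o Fin m) :
    Matrix (Fin d) (Fin m) (OverlapRing F I J) :=
  ((overlapMatrix F I J).submatrix id J)⁻¹ * overlapMatrix F I J

theorem transMatrix_submatrix (I J K : Fin d ↪o Fin m) :
    (transMatrix F I J).submatrix id K =
      ((overlapMatrix F I J).submatrix id J)⁻¹ * (overlapMatrix F I J).submatrix id K := by
  ext a b
  rfl

theorem transMatrix_submatrix_self (I J : Fin d ↪o Fin m) :
    (transMatrix F I J).submatrix id J = 1 := by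
  rw [transMatrix_submatrix]
  exact Matrix.nonsing_inv_mul _ (isUnit_det_overlapMatrix F I J)

/-- The homomorphism `R(J,I) → R(I,J)` induced by the matrix `x_J⁻¹ x` over `R(I,J)`. -/
noncomputable def transAlgHom (I J : Fin d ↪o Fin m) : OverlapRing F J I →ₐ[F] OverlapRing F I J :=
  IsLocalization.liftAlgHom (M := Submonoid.powers ((chartMatrix F J).submatrix id I).det)
    (f := chartLift F J (transMatrix F I J) (transMatrix_submatrix_self F I J)) (by
      have h : IsUnit (chartLift F J (transMatrix F I J) (transMatrix_submatrix_self F I J)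
          ((chartMatrix F J).submatrix id I).det) := by
        rw [AlgHom.map_det]
        have e : (chartLift F J (transMatrix F I J) (transMatrix_submatrix_self F I J)).mapMatrix
            ((chartMatrix F J).submatrix id I) = (transMatrix F I J).submatrix id I :=
          congrArg (fun A => Matrix.submatrix A id I)
            (chartLift_chartMatrix F J (transMatrix F I J) (transMatrix_submatrix_self F I J))
        rw [e, transMatrix_submatrix, overlapMatrix_submatrix, mul_one]
        exact (Matrix.isUnit_iff_isUnit_det _).1 ((Matrix.isUnit_nonsing_inv_iff).2
          ((Matrix.isUnit_iff_isUnit_det _).2 (isUnit_det_overlapMatrix F I J)))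
      rintro ⟨_, n, rfl⟩
      simpa using h.pow n)

/-- The affine chart `𝒲(I) = Spec R(I)`. -/
noncomputable def chart (I : Fin d ↪o Fin m) : Over (Spec (CommRingCat.of F)) :=
  specOver F (ChartRing F I)

/-- The open subscheme `𝒲(I,J) = Spec R(I,J)` of `𝒲(I)`. -/
noncomputable def overlap (I J : Fin d ↪o Fin m) : Over (Spec (CommRingCat.of F)) :=
  specOver F (OverlapRing F I J)

/-- The inclusion `𝒲(I,J) ⟶ 𝒲(I)`. -/
noncomputable def overlapInc (I J : Fin d ↪o Fin m) : overlap F I J ⟶ chart F I :=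
  specOverMap (IsScalarTower.toAlgHom F (ChartRing F I) (OverlapRing F I J))

/-- The transition morphism `𝒲(I,J) ⟶ 𝒲(J,I)`, `M ↦ M_J⁻¹ M` on points. -/
noncomputable def transition (I J : Fin d ↪o Fin m) : overlap F I J ⟶ overlap F J I :=
  specOverMap (transAlgHom F I J)

variable {F}

/-- The `F`-point of `𝒲(I)` given by a matrix `M` over `F` with `M_I = 1`. -/
noncomputable def chartPoint (I : Fin d ↪o Fin m) (M : Matrix (Fin d) (Fin m) F)
    (hM : M.submatrix id I = 1) : FPoints (chart F I) :=
  Over.homMk (Spec.map (CommRingCat.ofHom (chartLift F I M hM).toRingHom)) (by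
    simp only [chart, specOver, specBase, Over.mk_hom, ← Spec.map_comp, ← CommRingCat.ofHom_comp]
    rw [← Spec.map_id]
    congr 1
    ext x
    exact (chartLift F I M hM).commutes x)

end Grass

/-- The Grassmannian: the set of `d`-dimensional subspaces of `F^m`. -/
abbrev SubspaceGrassmannian (F : Type u) [Field F] (d m : ℕ) : Type u :=
  {N : Submodule F (Fin m → F) // Module.finrank F N = d}

/-! The gluing is carried out inside projective space by means of Plücker coordinates. Let `n + 1`
be the number of increasing sequences `J`, and send a matrix `M` to its maximal minors `det M_J`. On
`𝒲(I)` the coordinate `y_I` equals `1`, so the chart maps to `D₊(y_I)`. The entry `x_aj` is the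
minor for `I` with its `a`-th index replaced by `j`, hence zero or a Plücker coordinate up to sign.
So the coordinate ring of `D₊(y_I)` surjects onto `R(I)`, and `𝒲(I)` is closed in `D₊(y_I)`
(`chartAwayHom_surjective`). The part of `𝒲(I)` over `D₊(y_J)` is `𝒲(I,J)`
(`range_overlapInc_eq_preimage`). Left multiplication by `B` scales all Plücker coordinates by `det
B`, so the transition morphisms commute with the maps to `ℙⁿ` (`transition_compat`).

These facts form a `LocallyClosedAtlas`. Its cocycle identities need no matrix computation: both
sides agree over `ℙⁿ`, and the charts are monomorphisms into `ℙⁿ`. The part of the glued scheme over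
`D₊(y_I)` is exactly `𝒲(I)`, so the map to `ℙⁿ` is a closed immersion, this being local on the
target.

The statement on points holds for any gluing. `Spec F` has one point, so an `F`-point lies in some
chart and is given by a matrix `M` with `M_I = 1`. Matrices `M` and `M'`, normalized at `I` and `J`,
give the same point exactly if `M' = M_J⁻¹ M`, that is, if their row spaces agree. Every
`d`-dimensional subspace arises because a matrix of rank `d` has an invertible maximal minor. -/

/-! ### Gluing locally closed subschemes of an ambient scheme. -/

/-- A family of locally closed subschemes `U i` of `P`, each closed in an open subscheme `Y i`, such
that the `Y i` cover `P` and `U i ∩ Y j` is identified with `U j ∩ Y i` over `P`. -/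
structure LocallyClosedAtlas (P : Scheme.{u}) (J : Type u) where
  /-- the charts -/
  U : J → Scheme.{u}
  /-- the open subschemes of `P` -/
  Y : J → Scheme.{u}
  /-- the overlaps -/
  V : J → J → Scheme.{u}
  /-- the inclusion of an overlap -/
  inc : ∀ i j, V i j ⟶ U i
  /-- the transition morphisms -/
  t : ∀ i j, V i j ⟶ V j i
  /-- the closed immersion of a chart -/
  c : ∀ i, U i ⟶ Y i
  /-- the inclusion of an open subscheme -/
  o : ∀ i, Y i ⟶ P
  inc_open : ∀ i j, IsOpenImmersion (inc i j)
  c_closed : ∀ i, IsClosedImmersion (c i)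
  o_open : ∀ i, IsOpenImmersion (o i)
  range_inc : ∀ i j, Set.range (inc i j) = (c i ≫ o i) ⁻¹' Set.range (o j)
  t_inc : ∀ i j, t i j ≫ inc j i ≫ c j ≫ o j = inc i j ≫ c i ≫ o i
  cover : ∀ x : P, ∃ i, x ∈ Set.range (o i)

namespace LocallyClosedAtlas

open Limits

attribute [instance] inc_open c_closed o_open

variable {P : Scheme.{u}} {J : Type u} (A : LocallyClosedAtlas P J)

instance (i : J) : Mono (A.c i ≫ A.o i) := mono_comp _ _

instance (i j : J) : Mono (A.inc i j ≫ A.c i ≫ A.o i) := mono_comp _ _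

/-- Both projections of the triple overlap have the same image in `P`. The second one passes through
`V i k`, so this image lies in `Y k`, and `range_inc` applies to it in `U j`. -/
theorem range_subset (i j k : J) :
    Set.range (pullback.fst (A.inc i j) (A.inc i k) ≫ A.t i j ≫ A.inc j i) ⊆
      Set.range (A.inc j k) := by
  rintro _ ⟨z, rfl⟩
  rw [A.range_inc, Set.mem_preimage, ← Scheme.Hom.comp_apply]
  have h : (pullback.fst (A.inc i j) (A.inc i k) ≫ A.t i j ≫ A.inc j i) ≫ A.c j ≫ A.o j =
      pullback.snd (A.inc i j) (A.inc i k) ≫ A.inc i k ≫ A.c i ≫ A.o i := by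
    rw [Category.assoc, Category.assoc, A.t_inc, pullback.condition_assoc]
  rw [h, Scheme.Hom.comp_apply, Scheme.Hom.comp_apply, ← Set.mem_preimage, ← A.range_inc]
  exact ⟨_, rfl⟩

/-- The map between triple overlaps. -/
noncomputable def t' (i j k : J) :
    pullback (A.inc i j) (A.inc i k) ⟶ pullback (A.inc j k) (A.inc j i) :=
  pullback.lift (IsOpenImmersion.lift (A.inc j k) _ (A.range_subset i j k))
    (pullback.fst _ _ ≫ A.t i j) (by simp)

theorem t'_snd (i j k : J) :
    A.t' i j k ≫ pullback.snd (A.inc j k) (A.inc j i) = pullback.fst _ _ ≫ A.t i j :=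
  pullback.lift_snd _ _ _

theorem t'_over (i j k : J) :
    A.t' i j k ≫ pullback.fst (A.inc j k) (A.inc j i) ≫ A.inc j k ≫ A.c j ≫ A.o j =
      pullback.fst (A.inc i j) (A.inc i k) ≫ A.inc i j ≫ A.c i ≫ A.o i := by
  rw [pullback.condition_assoc, reassoc_of% A.t'_snd i j k, A.t_inc]

/-- The glue data of an atlas. -/
noncomputable def glueData : Scheme.GlueData.{u} where
  J := J
  U := A.U
  V p := A.V p.1 p.2
  f := A.inc
  f_id i := by
    refine isIso_of_isOpenImmersion_of_opensRange_eq_top _ (TopologicalSpace.Opens.ext ?_)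
    -- All of `U i` lies over `Y i`, so the self-overlap is the whole chart.
    refine (A.range_inc i i).trans (Set.eq_univ_of_forall fun x => ?_)
    exact ⟨A.c i x, (Scheme.Hom.comp_apply _ _ _).symm⟩
  t := A.t
  t_id i := by
    rw [← cancel_mono (A.inc i i ≫ A.c i ≫ A.o i), Category.id_comp, A.t_inc]
  t' := A.t'
  t_fac := A.t'_snd
  cocycle i j k := by
    -- All three maps of the cycle lie over `P`, and the triple overlap is a monomorphism into `P`.
    rw [← cancel_mono (pullback.fst (A.inc i j) (A.inc i k) ≫ A.inc i j ≫ A.c i ≫ A.o i),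
      Category.assoc, Category.assoc, A.t'_over k i j, A.t'_over j k i, A.t'_over i j k,
      Category.id_comp]
  f_open := A.inc_open

/-- The glued scheme of an atlas. -/
noncomputable def glued : Scheme.{u} := A.glueData.glued

/-- The chart `U i` of the glued scheme. -/
noncomputable def ι (i : J) : A.U i ⟶ A.glued := A.glueData.ι i

instance isOpenImmersion_ι (i : J) : IsOpenImmersion (A.ι i) := A.glueData.ι_isOpenImmersion i

theorem ι_jointly_surjective (x : A.glued) : ∃ (i : J) (z : A.U i), A.ι i z = x :=
  A.glueData.ι_jointly_surjective x

/-- The morphism from the glued scheme to the ambient scheme. -/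
noncomputable def toAmbient : A.glued ⟶ P :=
  Multicoequalizer.desc _ _ (fun i : J => A.c i ≫ A.o i) (by
    rintro ⟨i, j⟩
    exact (A.t_inc i j).symm.trans (Category.assoc _ _ _).symm)

theorem ι_toAmbient (i : J) : A.ι i ≫ A.toAmbient = A.c i ≫ A.o i :=
  Multicoequalizer.π_desc _ _ _ _ _

theorem glue_condition (i j : J) : A.t i j ≫ A.inc j i ≫ A.ι j = A.inc i j ≫ A.ι i :=
  A.glueData.glue_condition i j

theorem ι_mem_range_inc {i : J} (z : A.U i) {j : J}
    (h : A.toAmbient (A.ι i z) ∈ Set.range (A.o j)) : z ∈ Set.range (A.inc i j) := by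
  have e := Scheme.Hom.comp_apply (A.ι i) A.toAmbient z
  rw [A.ι_toAmbient] at e
  rw [A.range_inc, Set.mem_preimage]
  exact e ▸ h

theorem toAmbient_ι_mem (i : J) (z : A.U i) :
    A.toAmbient (A.ι i z) ∈ Set.range (A.o i) := by
  have e := Scheme.Hom.comp_apply (A.ι i) A.toAmbient z
  rw [A.ι_toAmbient] at e
  exact ⟨A.c i z, (Scheme.Hom.comp_apply _ _ _).symm.trans e⟩

/-- A point of chart `i` lying over `Y k` belongs to `V i k`, and the transition morphism moves it
into chart `k`. So no other chart contributes points over `Y k`. -/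
theorem preimage_range_o (k : J) :
    A.toAmbient ⁻¹' Set.range (A.o k) = Set.range (A.ι k) := by
  ext x
  constructor
  · intro hx
    obtain ⟨i, z, rfl⟩ := A.ι_jointly_surjective x
    obtain ⟨w, rfl⟩ := A.ι_mem_range_inc z hx
    refine ⟨(A.t i k ≫ A.inc k i) w, ?_⟩
    refine (Scheme.Hom.comp_apply (A.t i k ≫ A.inc k i) (A.ι k) w).symm.trans ?_
    refine Eq.trans ?_ (Scheme.Hom.comp_apply (A.inc i k) (A.ι i) w)
    rw [Category.assoc, A.glue_condition]
  · rintro ⟨z, rfl⟩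
    exact A.toAmbient_ι_mem k z

theorem range_inter_range (i j : J) :
    Set.range (A.ι i) ∩ Set.range (A.ι j) =
      Set.range (A.inc i j ≫ A.ι i) := by
  apply Set.Subset.antisymm
  · rintro _ ⟨⟨z, rfl⟩, hz⟩
    rw [← A.preimage_range_o] at hz
    obtain ⟨w, rfl⟩ := A.ι_mem_range_inc z hz
    exact ⟨w, Scheme.Hom.comp_apply _ _ _⟩
  · rintro _ ⟨w, rfl⟩
    refine ⟨⟨A.inc i j w, (Scheme.Hom.comp_apply _ _ _).symm⟩, ?_⟩
    rw [← A.glue_condition, ← Category.assoc]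
    exact ⟨(A.t i j ≫ A.inc j i) w, (Scheme.Hom.comp_apply _ _ _).symm⟩

instance isClosedImmersion_toAmbient : IsClosedImmersion A.toAmbient := by
  let 𝒰 : P.OpenCover :=
    { I₀ := J
      X := A.Y
      f := A.o
      mem₀ := by
        rw [Scheme.presieve₀_mem_precoverage_iff]
        exact ⟨A.cover, A.o_open⟩ }
  refine IsZariskiLocalAtTarget.of_openCover 𝒰 fun k => ?_
  -- The base change of `toAmbient` to `Y k` is the closed immersion `c k`.
  have h : IsPullback (A.c k) (A.ι k) (A.o k) A.toAmbient :=
    IsOpenImmersion.isPullback (A.c k) (A.ι k) (A.o k) A.toAmbient (A.ι_toAmbient k)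
      (TopologicalSpace.Opens.ext (A.preimage_range_o k))
  have h' : IsClosedImmersion (h.flip.isoPullback.inv ≫ A.c k) := inferInstance
  rw [h.flip.isoPullback_inv_snd] at h'
  exact h'

end LocallyClosedAtlas

/-! ### Morphisms from affine schemes to `Proj` -/

namespace Proj

section

variable {A σ T : Type*} [CommRing A] [SetLike σ A] [AddSubgroupClass σ A] (𝒜 : ℕ → σ)
  [GradedRing 𝒜] [CommRing T]

/-- The ring homomorphism `A_(f) → T` induced by `θ : A → T` if `θ f` is a unit. -/
noncomputable def awayLift (θ : A →+* T) (f : A) (hf : IsUnit (θ f)) :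
    HomogeneousLocalization.Away 𝒜 f →+* T :=
  (IsLocalization.Away.lift (S := Localization.Away f) f hf).comp
    (algebraMap (HomogeneousLocalization.Away 𝒜 f) (Localization.Away f))

/-- The defining property with denominators cleared: as `θ f` is a unit, it determines the value,
and later identities are checked after cancelling powers of this unit. -/
theorem awayLift_mk_mul (θ : A →+* T) {f : A} (hf : IsUnit (θ f)) {d : ℕ} (hd : f ∈ 𝒜 d) (n : ℕ)
    (a : A) (ha : a ∈ 𝒜 (n • d)) :
    awayLift 𝒜 θ f hf (HomogeneousLocalization.Away.mk 𝒜 hd n a ha) * θ f ^ n = θ a := by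
  rw [awayLift, RingHom.comp_apply, HomogeneousLocalization.algebraMap_apply,
    HomogeneousLocalization.Away.val_mk, Localization.mk_eq_mk']
  rw [← map_pow, ← IsLocalization.Away.lift_eq (S := Localization.Away f) f hf (f ^ n), ← map_mul,
    ← IsLocalization.Away.lift_eq (S := Localization.Away f) f hf a]
  congr 1
  exact IsLocalization.mk'_spec (Localization.Away f) a (⟨f ^ n, n, rfl⟩ : Submonoid.powers f)

/-- Numerator and denominator have the same degree, so the powers of `u` cancel. -/
theorem awayLift_eq_of_scaling {θ θ' : A →+* T} {f : A} (hf : IsUnit (θ f)) (hf' : IsUnit (θ' f))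
    {d : ℕ} (hd : f ∈ 𝒜 d) (u : T) (h : ∀ n, ∀ a ∈ 𝒜 n, θ' a = u ^ n * θ a) :
    awayLift 𝒜 θ' f hf' = awayLift 𝒜 θ f hf := by
  ext z
  obtain ⟨n, a, ha, rfl⟩ := HomogeneousLocalization.Away.mk_surjective 𝒜 hd z
  apply (hf'.pow n).mul_right_cancel
  rw [awayLift_mk_mul, h _ _ ha, h _ _ hd, mul_pow, mul_left_comm, awayLift_mk_mul, ← pow_mul,
    smul_eq_mul, mul_comm n d]

theorem comp_awayLift {T' : Type*} [CommRing T'] (φ : T →+* T') (θ : A →+* T) {f : A}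
    (hf : IsUnit (θ f)) {d : ℕ} (hd : f ∈ 𝒜 d) :
    φ.comp (awayLift 𝒜 θ f hf) = awayLift 𝒜 (φ.comp θ) f (hf.map φ) := by
  ext z
  obtain ⟨n, a, ha, rfl⟩ := HomogeneousLocalization.Away.mk_surjective 𝒜 hd z
  apply ((hf.map φ).pow n).mul_right_cancel
  rw [RingHom.comp_apply]
  refine Eq.trans ?_ (awayLift_mk_mul 𝒜 (φ.comp θ) (hf.map φ) hd n a ha).symm
  rw [RingHom.comp_apply, ← awayLift_mk_mul 𝒜 θ hf hd n a ha, map_mul, map_pow]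

theorem awayLift_comp_awayMap (θ : A →+* T) {f g x : A} {d e : ℕ} (hd : f ∈ 𝒜 d) (he : g ∈ 𝒜 e)
    (hx : x = f * g) (hf : IsUnit (θ f)) (hfg : IsUnit (θ x)) :
    (awayLift 𝒜 θ x hfg).comp (HomogeneousLocalization.awayMap 𝒜 he hx) =
      awayLift 𝒜 θ f hf := by
  ext z
  obtain ⟨n, a, ha, rfl⟩ := HomogeneousLocalization.Away.mk_surjective 𝒜 hd z
  apply (hfg.pow n).mul_right_cancel
  rw [RingHom.comp_apply, HomogeneousLocalization.awayMap_mk, awayLift_mk_mul, hx, map_mul, map_mul,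
    map_pow, mul_pow, ← mul_assoc, awayLift_mk_mul]

theorem awayLift_fromZeroRingHom (θ : A →+* T) (f : A) (hf : IsUnit (θ f)) (a : 𝒜 0) :
    awayLift 𝒜 θ f hf (HomogeneousLocalization.fromZeroRingHom 𝒜 _ a) = θ a := by
  rw [awayLift, RingHom.comp_apply, HomogeneousLocalization.algebraMap_apply]
  refine Eq.trans (congrArg _ ?_) (IsLocalization.Away.lift_eq (S := Localization.Away f) f hf a.1)
  exact Localization.mk_one_eq_algebraMap _

end

section

variable {A σ T : Type u} [CommRing A] [SetLike σ A] [AddSubgroupClass σ A] (𝒜 : ℕ → σ)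
  [GradedRing 𝒜] [CommRing T]

/-- The morphism `Spec T ⟶ Proj A` induced by `θ : A → T` if `θ f` is a unit. -/
noncomputable def ofAway (θ : A →+* T) {f : A} {d : ℕ} (hd : f ∈ 𝒜 d) (pos : 0 < d)
    (hf : IsUnit (θ f)) : Spec (CommRingCat.of T) ⟶ Proj 𝒜 :=
  Spec.map (CommRingCat.ofHom (awayLift 𝒜 θ f hf)) ≫ Proj.awayι 𝒜 f hd pos

theorem specMap_ofAway {T' : Type u} [CommRing T'] (φ : T →+* T') (θ : A →+* T) {f : A} {d : ℕ}
    (hd : f ∈ 𝒜 d) (pos : 0 < d) (hf : IsUnit (θ f)) :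
    Spec.map (CommRingCat.ofHom φ) ≫ ofAway 𝒜 θ hd pos hf =
      ofAway 𝒜 (φ.comp θ) hd pos (hf.map φ) := by
  rw [ofAway, ofAway, ← Category.assoc, ← Spec.map_comp, ← CommRingCat.ofHom_comp,
    comp_awayLift 𝒜 φ θ hf hd]

theorem ofAway_eq_of_mul (θ : A →+* T) {f g x : A} {d e : ℕ} (hd : f ∈ 𝒜 d) (pos : 0 < d)
    (he : g ∈ 𝒜 e) (hx : x = f * g) (hf : IsUnit (θ f)) (hfg : IsUnit (θ x)) :
    ofAway 𝒜 θ hd pos hf =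
      ofAway 𝒜 θ (hx ▸ SetLike.mul_mem_graded hd he : x ∈ 𝒜 (d + e)) (by omega) hfg := by
  rw [ofAway, ofAway, ← Proj.SpecMap_awayMap_awayι 𝒜 hd pos he hx, ← Category.assoc,
    ← Spec.map_comp, ← CommRingCat.ofHom_comp, awayLift_comp_awayMap 𝒜 θ hd he hx hf hfg]

/-- Both morphisms factor through `D₊(fg)`, where they coincide. -/
theorem ofAway_eq (θ : A →+* T) {f g : A} {d e : ℕ} (hd : f ∈ 𝒜 d) (pos : 0 < d)
    (he : g ∈ 𝒜 e) (pos' : 0 < e) (hf : IsUnit (θ f)) (hg : IsUnit (θ g)) :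
    ofAway 𝒜 θ hd pos hf = ofAway 𝒜 θ he pos' hg := by
  have h : IsUnit (θ (f * g)) := by rw [map_mul]; exact hf.mul hg
  rw [ofAway_eq_of_mul 𝒜 θ hd pos he rfl hf h, ofAway_eq_of_mul 𝒜 θ he pos' hd (mul_comm f g) hg h]
  congr 1
  rw [add_comm]

theorem ofAway_eq_of_scaling {θ θ' : A →+* T} {f : A} (hf : IsUnit (θ f)) (hf' : IsUnit (θ' f))
    {d : ℕ} (hd : f ∈ 𝒜 d) (pos : 0 < d) (u : T) (h : ∀ n, ∀ a ∈ 𝒜 n, θ' a = u ^ n * θ a) :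
    ofAway 𝒜 θ' hd pos hf' = ofAway 𝒜 θ hd pos hf := by
  rw [ofAway, ofAway, awayLift_eq_of_scaling 𝒜 hf hf' hd u h]

theorem ofAway_toSpecZero (θ : A →+* T) {f : A} {d : ℕ} (hd : f ∈ 𝒜 d) (pos : 0 < d)
    (hf : IsUnit (θ f)) : ofAway 𝒜 θ hd pos hf ≫ Proj.toSpecZero 𝒜 =
      Spec.map (CommRingCat.ofHom (θ.comp (algebraMap (𝒜 0) A))) := by
  rw [ofAway, Category.assoc, Proj.awayι_toSpecZero, ← Spec.map_comp, ← CommRingCat.ofHom_comp]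
  congr 2
  ext a
  exact awayLift_fromZeroRingHom 𝒜 θ f hf a

end

end Proj

/-! ### Maximal minors -/

/-- An injective family of column indices is an increasing one up to a permutation. -/
theorem exists_orderEmbedding_comp_perm {d m : ℕ} {h : Fin d → Fin m} (hh : Function.Injective h) :
    ∃ (J : Fin d ↪o Fin m) (σ : Equiv.Perm (Fin d)), h = J ∘ σ := by
  refine ⟨OrderEmbedding.ofStrictMono (h ∘ Tuple.sort h)
    ((Tuple.monotone_sort h).strictMono_of_injective (hh.comp (Equiv.injective _))),
    (Tuple.sort h).symm, ?_⟩
  ext a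
  simp

/-- This is Cramer's rule for the identity matrix with column `a` replaced. It recovers every entry
of a normalized matrix as a minor. -/
theorem Matrix.det_submatrix_update {d m : ℕ} {T : Type*} [CommRing T]
    (M : Matrix (Fin d) (Fin m) T) (I : Fin d → Fin m) (hI : M.submatrix id I = 1)
    (a : Fin d) (j : Fin m) : (M.submatrix id (Function.update I a j)).det = M a j := by
  have h : M.submatrix id (Function.update I a j) =
      (1 : Matrix (Fin d) (Fin d) T).updateCol a (fun b => M b j) := by
    rw [← hI]
    ext b c
    by_cases e : c = a
    · subst e
      simp
    · simp [e]
  rw [h, ← Matrix.cramer_apply, Matrix.cramer_one]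
  rfl

/-- A subring containing the maximal minors contains the minors with respect to all column
families. -/
theorem Matrix.det_submatrix_mem {d m : ℕ} {T : Type*} [CommRing T]
    (M : Matrix (Fin d) (Fin m) T) (S : Subring T)
    (hS : ∀ J : Fin d ↪o Fin m, (M.submatrix id J).det ∈ S) (h : Fin d → Fin m) :
    (M.submatrix id h).det ∈ S := by
  -- An injective family changes an increasing minor only by a sign; a repeated column makes the
  -- minor vanish.
  by_cases hh : Function.Injective h
  · obtain ⟨J, σ, rfl⟩ := exists_orderEmbedding_comp_perm hh
    have e : M.submatrix id (J ∘ σ) = (M.submatrix id J).submatrix id σ := rfl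
    rw [e, Matrix.det_permute']
    refine S.mul_mem ?_ (hS J)
    rcases Int.units_eq_one_or (Equiv.Perm.sign σ) with h | h <;> simp [h]
  · simp only [Function.Injective, not_forall] at hh
    obtain ⟨a, b, hab, ne⟩ := hh
    rw [Matrix.det_zero_of_column_eq ne (fun k => by simp [hab])]
    exact S.zero_mem

/-- Evaluation of a homogeneous polynomial at a scaled point. -/
theorem MvPolynomial.aeval_mul_of_isHomogeneous {σ F T : Type*} [CommRing F] [CommRing T] [Algebra F T]
    {p : MvPolynomial σ F} {k : ℕ} (hp : p.IsHomogeneous k) (u : T) (v : σ → T) :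
    aeval (fun i => u * v i) p = u ^ k * aeval v p := by
  rw [aeval_def, aeval_def, eval₂_eq, eval₂_eq, Finset.mul_sum]
  refine Finset.sum_congr rfl fun s hs => ?_
  have h : ∑ i ∈ s.support, s i = k := by
    exact (DFunLike.congr_fun Finsupp.degree_eq_weight_one s).trans (hp (mem_support_iff.1 hs))
  simp only [mul_pow, Finset.prod_mul_distrib, Finset.prod_pow_eq_pow_sum, h]
  ring

theorem specOverMap_comp {F : Type u} [Field F] {A B C : Type u} [CommRing A] [CommRing B]
    [CommRing C] [Algebra F A] [Algebra F B] [Algebra F C] (g : B →ₐ[F] C) (f : A →ₐ[F] B) :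
    specOverMap g ≫ specOverMap f = specOverMap (g.comp f) := by
  ext : 1
  exact (Spec.map_comp _ _).symm

/-! ### The Plücker embedding -/

namespace Grass

variable (F : Type u) [Field F] {d m n : ℕ} (e : (Fin d ↪o Fin m) ≃ Fin (n + 1))

section

variable {T : Type*} [CommRing T] [Algebra F T]

/-- The Plücker coordinates of a matrix. -/
noncomputable def plucker (M : Matrix (Fin d) (Fin m) T) : MvPolynomial (Fin (n + 1)) F →ₐ[F] T :=
  MvPolynomial.aeval fun k => (M.submatrix id (e.symm k)).det

theorem plucker_X (M : Matrix (Fin d) (Fin m) T) (I : Fin d ↪o Fin m) :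
    plucker F e M (MvPolynomial.X (e I)) = (M.submatrix id I).det := by
  simp [plucker]

theorem comp_plucker {T' : Type*} [CommRing T'] [Algebra F T'] (φ : T →ₐ[F] T')
    (M : Matrix (Fin d) (Fin m) T) : φ.comp (plucker F e M) = plucker F e (M.map φ) := by
  refine MvPolynomial.algHom_ext fun k => ?_
  simp only [plucker, AlgHom.comp_apply, MvPolynomial.aeval_X]
  exact AlgHom.map_det φ _

theorem plucker_mul (B : Matrix (Fin d) (Fin d) T) (M : Matrix (Fin d) (Fin m) T) {k : ℕ}
    {p : MvPolynomial (Fin (n + 1)) F} (hp : p.IsHomogeneous k) :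
    plucker F e (B * M) p = B.det ^ k * plucker F e M p := by
  rw [plucker, plucker, ← MvPolynomial.aeval_mul_of_isHomogeneous hp]
  congr 2
  ext k
  rw [← Matrix.det_mul]
  rfl

end

theorem isUnit_plucker_X {T : Type*} [CommRing T] [Algebra F T] {M : Matrix (Fin d) (Fin m) T}
    {I : Fin d ↪o Fin m} (h : IsUnit (M.submatrix id I).det) :
    IsUnit ((plucker F e M).toRingHom (MvPolynomial.X (e I))) := by
  refine Eq.mpr (congrArg IsUnit ?_) h
  exact plucker_X F e M I

local notation "ℋ" => MvPolynomial.homogeneousSubmodule (Fin (n + 1)) F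

theorem X_mem (k : Fin (n + 1)) : MvPolynomial.X k ∈ ℋ 1 := MvPolynomial.isHomogeneous_X F k

/-- The point of projective space given by the Plücker coordinates of a matrix. -/
noncomputable def pluckerPoint {T : Type u} [CommRing T] [Algebra F T]
    (M : Matrix (Fin d) (Fin m) T) (I : Fin d ↪o Fin m) (h : IsUnit (M.submatrix id I).det) :
    Spec (CommRingCat.of T) ⟶ (projSpace F n).left :=
  Proj.ofAway ℋ (plucker F e M).toRingHom (X_mem F (e I)) one_pos (isUnit_plucker_X F e h)

theorem specMap_pluckerPoint {T T' : Type u} [CommRing T] [Algebra F T] [CommRing T'] [Algebra F T']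
    (φ : T →ₐ[F] T') (M : Matrix (Fin d) (Fin m) T) (I : Fin d ↪o Fin m)
    (h : IsUnit (M.submatrix id I).det) (h' : IsUnit ((M.map φ).submatrix id I).det) :
    Spec.map (CommRingCat.ofHom φ.toRingHom) ≫ pluckerPoint F e M I h =
      pluckerPoint F e (M.map φ) I h' := by
  refine (Proj.specMap_ofAway ℋ _ _ _ _ _).trans ?_
  rw [pluckerPoint]
  congr 1
  rw [← comp_plucker]
  rfl

/-- Row operations scale all Plücker coordinates by `det B`, which is invisible in projective space.
The nonvanishing coordinate used to define the point may change as well. -/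
theorem pluckerPoint_mul {T : Type u} [CommRing T] [Algebra F T]
    (B : Matrix (Fin d) (Fin d) T) (M : Matrix (Fin d) (Fin m) T) (I J : Fin d ↪o Fin m)
    (h : IsUnit (M.submatrix id I).det) (h' : IsUnit ((B * M).submatrix id J).det) :
    pluckerPoint F e (B * M) J h' = pluckerPoint F e M I h := by
  have hJ : IsUnit (M.submatrix id J).det := by
    have hmul : (B * M).submatrix id J = B * M.submatrix id J := rfl
    rw [hmul, Matrix.det_mul] at h'
    exact isUnit_of_mul_isUnit_right h'
  refine (Proj.ofAway_eq_of_scaling ℋ (isUnit_plucker_X F e hJ) (isUnit_plucker_X F e h')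
    (X_mem F (e J)) one_pos B.det fun k p hp => plucker_mul F e B M hp).trans ?_
  exact Proj.ofAway_eq ℋ _ _ _ _ _ _ _

theorem pluckerPoint_hom {T : Type u} [CommRing T] [Algebra F T]
    (M : Matrix (Fin d) (Fin m) T) (I : Fin d ↪o Fin m) (h : IsUnit (M.submatrix id I).det) :
    pluckerPoint F e M I h ≫ (projSpace F n).hom =
      Spec.map (CommRingCat.ofHom (algebraMap F T)) := by
  have := Proj.ofAway_toSpecZero ℋ (plucker F e M).toRingHom (X_mem F (e I)) one_pos
    (isUnit_plucker_X F e h)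
  simp only [projSpace, Over.mk_hom]
  rw [pluckerPoint, reassoc_of% this, ← Spec.map_comp, ← CommRingCat.ofHom_comp]
  congr 2
  exact (plucker F e M).comp_algebraMap

/-! ### The charts of the Plücker embedding -/

theorem isUnit_det_chartMatrix (I : Fin d ↪o Fin m) :
    IsUnit ((chartMatrix F I).submatrix id I).det := by
  rw [chartMatrix_submatrix, Matrix.det_one]
  exact isUnit_one

/-- The homomorphism from the coordinate ring of the standard open set `D₊(y_I)` of projective space
to `R(I)`. -/
noncomputable def chartAwayHom (I : Fin d ↪o Fin m) :
    HomogeneousLocalization.Away ℋ (MvPolynomial.X (e I)) →+* ChartRing F I :=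
  Proj.awayLift ℋ (plucker F e (chartMatrix F I)).toRingHom (MvPolynomial.X (e I))
    (isUnit_plucker_X F e (isUnit_det_chartMatrix F I))

/-- The denominator disappears because `y_I` goes to `det 1 = 1`. -/
theorem chartAwayHom_mk (I : Fin d ↪o Fin m) (k : ℕ) (p : MvPolynomial (Fin (n + 1)) F)
    (hp : p ∈ ℋ (k • 1)) :
    chartAwayHom F e I (HomogeneousLocalization.Away.mk ℋ (X_mem F (e I)) k p hp) =
      plucker F e (chartMatrix F I) p := by
  have h := Proj.awayLift_mk_mul ℋ (plucker F e (chartMatrix F I)).toRingHom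
    (isUnit_plucker_X F e (isUnit_det_chartMatrix F I)) (X_mem F (e I)) k p hp
  have h1 : (plucker F e (chartMatrix F I)).toRingHom (MvPolynomial.X (e I)) = 1 := by
    refine (plucker_X F e (chartMatrix F I) I).trans ?_
    rw [chartMatrix_submatrix, Matrix.det_one]
  rw [h1, one_pow, mul_one] at h
  exact h

theorem chartAwayHom_surjective (I : Fin d ↪o Fin m) :
    Function.Surjective (chartAwayHom F e I) := by
  have hdet : ∀ J : Fin d ↪o Fin m,
      ((chartMatrix F I).submatrix id J).det ∈ (chartAwayHom F e I).range := fun J =>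
    ⟨HomogeneousLocalization.Away.mk ℋ (X_mem F (e I)) 1 (MvPolynomial.X (e J)) (X_mem F (e J)),
      (chartAwayHom_mk F e I 1 _ _).trans (plucker_X F e _ J)⟩
  intro z
  obtain ⟨p, rfl⟩ := Ideal.Quotient.mk_surjective z
  change Ideal.Quotient.mk (chartIdeal F I) p ∈ (chartAwayHom F e I).range
  induction p using MvPolynomial.induction_on with
  | C c =>
    exact ⟨_, (chartAwayHom_mk F e I 0 (MvPolynomial.C c) (MvPolynomial.isHomogeneous_C _ c)).trans
      ((plucker F e (chartMatrix F I)).commutes c)⟩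
  | add p q hp hq => rw [map_add]; exact add_mem hp hq
  | mul_X p ij hp =>
    rw [map_mul]
    refine mul_mem hp ?_
    -- The variable `x_aj` is the minor for `I` with its `a`-th index replaced by `j`.
    have h := Matrix.det_submatrix_mem (chartMatrix F I) _ hdet (Function.update I ij.1 ij.2)
    rw [Matrix.det_submatrix_update _ _ (chartMatrix_submatrix F I)] at h
    simpa [chartMatrix] using h

theorem range_overlapInc (I J : Fin d ↪o Fin m) : Set.range (overlapInc F I J).left =
    (PrimeSpectrum.basicOpen ((chartMatrix F I).submatrix id J).det : Set (PrimeSpectrum _)) :=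
  PrimeSpectrum.localization_away_comap_range (OverlapRing F I J)
    ((chartMatrix F I).submatrix id J).det

instance isOpenImmersion_overlapInc (I J : Fin d ↪o Fin m) :
    IsOpenImmersion (overlapInc F I J).left :=
  inferInstanceAs (IsOpenImmersion (Spec.map (CommRingCat.ofHom
    (algebraMap (ChartRing F I) (OverlapRing F I J)))))

theorem chartAwayHom_isLocalizationElem (I J : Fin d ↪o Fin m) :
    chartAwayHom F e I (HomogeneousLocalization.Away.isLocalizationElem (X_mem F (e I))
      (X_mem F (e J))) = ((chartMatrix F I).submatrix id J).det := by
  refine (chartAwayHom_mk F e I 1 _ _).trans ?_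
  rw [pow_one, plucker_X]

/-- The standard open set `D₊(y_I)` of projective space. -/
noncomputable def awayChart (I : Fin d ↪o Fin m) :
    Spec (CommRingCat.of (HomogeneousLocalization.Away ℋ (MvPolynomial.X (e I)))) ⟶
      (projSpace F n).left :=
  Proj.awayι ℋ (MvPolynomial.X (e I)) (X_mem F (e I)) one_pos

instance isOpenImmersion_awayChart (I : Fin d ↪o Fin m) : IsOpenImmersion (awayChart F e I) :=
  inferInstanceAs (IsOpenImmersion (Proj.awayι _ _ _ _))

/-- The closed immersion of a chart into the standard open set of projective space. -/
noncomputable def chartToAway (I : Fin d ↪o Fin m) : (chart F I).left ⟶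
    Spec (CommRingCat.of (HomogeneousLocalization.Away ℋ (MvPolynomial.X (e I)))) :=
  Spec.map (CommRingCat.ofHom (chartAwayHom F e I))

instance isClosedImmersion_chartToAway (I : Fin d ↪o Fin m) :
    IsClosedImmersion (chartToAway F e I) :=
  IsClosedImmersion.spec_of_surjective _ (chartAwayHom_surjective F e I)

theorem chartToAway_awayChart (I : Fin d ↪o Fin m) : chartToAway F e I ≫ awayChart F e I =
    pluckerPoint F e (chartMatrix F I) I (isUnit_det_chartMatrix F I) := rfl

theorem range_awayChart (J : Fin d ↪o Fin m) : Set.range (awayChart F e J) =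
    (Proj.basicOpen ℋ (MvPolynomial.X (e J)) : Set (Proj ℋ)) :=
  congrArg (fun U : (Proj ℋ).Opens => (U : Set (Proj ℋ)))
    (Proj.opensRange_awayι ℋ (MvPolynomial.X (e J)) (X_mem F (e J)) one_pos)

/-- Inside `D₊(y_I)` the set `D₊(y_J)` is the locus where `y_J / y_I` is invertible, and this
function pulls back to `det x_J`. -/
theorem range_overlapInc_eq_preimage (I J : Fin d ↪o Fin m) : Set.range (overlapInc F I J).left =
    (chartToAway F e I ≫ awayChart F e I) ⁻¹' Set.range (awayChart F e J) := by
  have h := Proj.awayι_preimage_basicOpen ℋ (X_mem F (e I)) one_pos (X_mem F (e J)) one_pos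
  have h' : awayChart F e I ⁻¹' Set.range (awayChart F e J) = (PrimeSpectrum.basicOpen
      (HomogeneousLocalization.Away.isLocalizationElem (X_mem F (e I)) (X_mem F (e J))) :
        Set (PrimeSpectrum _)) := by
    rw [range_awayChart]
    exact congrArg TopologicalSpace.Opens.carrier h
  have h2 : (chartToAway F e I ≫ awayChart F e I) ⁻¹' Set.range (awayChart F e J) =
      chartToAway F e I ⁻¹' (awayChart F e I ⁻¹' Set.range (awayChart F e J)) := by
    rw [← Set.preimage_comp]
    congr 1
  rw [h2, h', range_overlapInc, ← chartAwayHom_isLocalizationElem F e I J]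
  rfl

theorem transAlgHom_comp (I J : Fin d ↪o Fin m) :
    (transAlgHom F I J).comp (IsScalarTower.toAlgHom F (ChartRing F J) (OverlapRing F J I)) =
      chartLift F J (transMatrix F I J) (transMatrix_submatrix_self F I J) := by
  refine AlgHom.ext fun z => ?_
  change transAlgHom F I J (algebraMap (ChartRing F J) (OverlapRing F J I) z) = _
  rw [transAlgHom, IsLocalization.liftAlgHom_apply, IsLocalization.lift_eq]
  rfl

theorem transition_overlapInc (I J : Fin d ↪o Fin m) : transition F I J ≫ overlapInc F J I =
    specOverMap (chartLift F J (transMatrix F I J) (transMatrix_submatrix_self F I J)) := by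
  rw [← transAlgHom_comp]
  exact specOverMap_comp _ _

/-- Over `R(I,J)` the two sides are the Plücker points of `x_J⁻¹ x` and of `x`, so
`pluckerPoint_mul` identifies them. -/
theorem transition_compat (I J : Fin d ↪o Fin m) :
    (transition F I J).left ≫ (overlapInc F J I).left ≫ chartToAway F e J ≫ awayChart F e J =
      (overlapInc F I J).left ≫ chartToAway F e I ≫ awayChart F e I := by
  rw [← Category.assoc, ← Over.comp_left, transition_overlapInc, chartToAway_awayChart,
    chartToAway_awayChart]
  have h1 : IsUnit (((chartMatrix F J).map (chartLift F J (transMatrix F I J)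
      (transMatrix_submatrix_self F I J))).submatrix id J).det := by
    rw [chartLift_chartMatrix, transMatrix_submatrix_self, Matrix.det_one]
    exact isUnit_one
  have h2 : IsUnit ((overlapMatrix F I J).submatrix id I).det := by
    rw [overlapMatrix_submatrix, Matrix.det_one]
    exact isUnit_one
  refine (specMap_pluckerPoint F e (chartLift F J (transMatrix F I J)
    (transMatrix_submatrix_self F I J)) (chartMatrix F J) J _ h1).trans ?_
  refine Eq.trans ?_ (specMap_pluckerPoint F e (IsScalarTower.toAlgHom F (ChartRing F I)
    (OverlapRing F I J)) (chartMatrix F I) I _ h2).symm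
  have h3 := chartLift_chartMatrix F J (transMatrix F I J) (transMatrix_submatrix_self F I J)
  refine Eq.trans ?_ (pluckerPoint_mul F e ((overlapMatrix F I J).submatrix id J)⁻¹
    (overlapMatrix F I J) I J h2 (by rw [← transMatrix, ← h3]; exact h1))
  congr 1

theorem exists_mem_range_awayChart (x : (projSpace F n).left) :
    ∃ I, x ∈ Set.range (awayChart F e I) := by
  have h : (⨆ k : Fin (n + 1), Proj.basicOpen ℋ (MvPolynomial.X k)) = ⊤ := by
    refine Proj.iSup_basicOpen_eq_top' ℋ _ (fun k => ⟨1, X_mem F k⟩) (top_le_iff.1 fun p _ => ?_)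
    induction p using MvPolynomial.induction_on with
    | C c =>
      exact Subalgebra.algebraMap_mem _ (⟨MvPolynomial.C c, MvPolynomial.isHomogeneous_C _ c⟩ : ℋ 0)
    | add p q hp hq => exact add_mem (hp trivial) (hq trivial)
    | mul_X p k hp => exact mul_mem (hp trivial) (Algebra.subset_adjoin ⟨k, rfl⟩)
  have hx : x ∈ (⨆ k : Fin (n + 1), Proj.basicOpen ℋ (MvPolynomial.X k)) := h ▸ trivial
  obtain ⟨k, hk⟩ := TopologicalSpace.Opens.mem_iSup.1 hx
  refine ⟨e.symm k, ?_⟩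
  rw [range_awayChart, Equiv.apply_symm_apply]
  exact hk

/-- The atlas of the Grassmann scheme in projective space. -/
noncomputable def atlas : LocallyClosedAtlas (projSpace F n).left (ULift.{u} (Fin d ↪o Fin m)) where
  U I := (chart F I.down).left
  Y I := Spec (CommRingCat.of (HomogeneousLocalization.Away ℋ (MvPolynomial.X (e I.down))))
  V I J := (overlap F I.down J.down).left
  inc I J := (overlapInc F I.down J.down).left
  t I J := (transition F I.down J.down).left
  c I := chartToAway F e I.down
  o I := awayChart F e I.down
  inc_open I J := isOpenImmersion_overlapInc F I.down J.down
  c_closed I := isClosedImmersion_chartToAway F e I.down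
  o_open I := isOpenImmersion_awayChart F e I.down
  range_inc I J := range_overlapInc_eq_preimage F e I.down J.down
  t_inc I J := transition_compat F e I.down J.down
  cover x := by
    obtain ⟨I, hI⟩ := exists_mem_range_awayChart F e x
    exact ⟨⟨I⟩, hI⟩

/-- The Grassmann scheme. -/
noncomputable def grassmannScheme : Over (Spec (CommRingCat.of F)) :=
  Over.mk ((atlas F e).toAmbient ≫ (projSpace F n).hom)

/-- The chart of the Grassmann scheme given by an index sequence. -/
noncomputable def grassmannChart (I : Fin d ↪o Fin m) : chart F I ⟶ grassmannScheme F e :=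
  Over.homMk ((atlas F e).ι ⟨I⟩) (by
    refine (Category.assoc _ _ _).symm.trans ?_
    refine (congrArg (· ≫ (projSpace F n).hom) ((atlas F e).ι_toAmbient ⟨I⟩)).trans ?_
    exact pluckerPoint_hom F e (chartMatrix F I) I (isUnit_det_chartMatrix F I))

/-- The Plücker embedding. -/
noncomputable def pluckerEmbedding : grassmannScheme F e ⟶ projSpace F n :=
  Over.homMk (atlas F e).toAmbient rfl

theorem isProjectiveScheme_grassmannScheme : IsProjectiveScheme (grassmannScheme F e) :=
  ⟨n, pluckerEmbedding F e, (atlas F e).isClosedImmersion_toAmbient⟩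

theorem isGluing_grassmannChart :
    IsGluing (overlapInc F) (transition F) (grassmannChart F e) where
  isOpenImmersion I := (atlas F e).isOpenImmersion_ι ⟨I⟩
  compat I J := by
    ext : 1
    exact (atlas F e).glue_condition ⟨I⟩ ⟨J⟩
  cover := by
    refine Set.eq_univ_of_forall fun x => ?_
    obtain ⟨I, z, hz⟩ := (atlas F e).ι_jointly_surjective x
    exact Set.mem_iUnion.2 ⟨I.down, z, hz⟩
  inter_left I J := (atlas F e).range_inter_range ⟨I⟩ ⟨J⟩
  inter_right I J := by
    rw [Set.inter_comm]
    exact (atlas F e).range_inter_range ⟨J⟩ ⟨I⟩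

end Grass

/-! ### Points over the base field -/

namespace Grass

variable {F : Type u} [Field F] {d m : ℕ}

/-! ### Row spaces and normalized matrices. -/

section LinearAlgebra

variable {M M' : Matrix (Fin d) (Fin m) F} {I J : Fin d ↪o Fin m}

theorem finrank_span_row (hM : M.submatrix id I = 1) :
    Module.finrank F (Submodule.span F (Set.range M.row)) = d := by
  have h : LinearIndependent F M.row := by
    have h1 : LinearIndependent F (M.submatrix id I).row :=
      Matrix.linearIndependent_rows_iff_isUnit.2 (hM ▸ isUnit_one)
    -- `funLeft` restricts a row to the columns in `I`, where the rows become those of the identity.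
    exact LinearIndependent.of_comp (LinearMap.funLeft F F I) h1
  simpa using finrank_span_eq_card h

/-- Each row of a matrix in the row space of `M` is a combination of the rows of `M`. -/
theorem exists_eq_mul_of_range_subset
    (h : Set.range M'.row ⊆ Submodule.span F (Set.range M.row)) :
    ∃ B : Matrix (Fin d) (Fin d) F, M' = B * M := by
  have h1 : ∀ a, ∃ c : Fin d → F, ∑ b, c b • M.row b = M'.row a := fun a =>
    (Submodule.mem_span_range_iff_exists_fun F).1 (h ⟨a, rfl⟩)
  choose B hB using h1
  refine ⟨Matrix.of B, ?_⟩
  ext a j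
  have := congrFun (hB a) j
  simp only [Finset.sum_apply, Pi.smul_apply, smul_eq_mul, Matrix.row_apply] at this
  rw [Matrix.mul_apply, ← this]
  rfl

theorem span_row_mul_le (B : Matrix (Fin d) (Fin d) F) :
    Submodule.span F (Set.range (B * M).row) ≤ Submodule.span F (Set.range M.row) := by
  rw [Submodule.span_le]
  rintro _ ⟨a, rfl⟩
  refine (Submodule.mem_span_range_iff_exists_fun F).2 ⟨B a, ?_⟩
  ext j
  simp [Matrix.mul_apply, Finset.sum_apply]

/-- The transform `M_J⁻¹ M` of a matrix. -/
noncomputable def normalize (J : Fin d ↪o Fin m) (M : Matrix (Fin d) (Fin m) F) :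
    Matrix (Fin d) (Fin m) F :=
  (M.submatrix id J)⁻¹ * M

theorem normalize_submatrix (hJ : IsUnit (M.submatrix id J).det) :
    (normalize J M).submatrix id J = 1 :=
  Matrix.nonsing_inv_mul _ hJ

theorem mul_normalize (hJ : IsUnit (M.submatrix id J).det) :
    M.submatrix id J * normalize J M = M := by
  rw [normalize, ← Matrix.mul_assoc, Matrix.mul_nonsing_inv _ hJ, Matrix.one_mul]

theorem span_row_normalize (hJ : IsUnit (M.submatrix id J).det) :
    Submodule.span F (Set.range (normalize J M).row) = Submodule.span F (Set.range M.row) := by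
  refine le_antisymm (span_row_mul_le _) ?_
  conv_lhs => rw [← mul_normalize hJ]
  exact span_row_mul_le _

/-- Write `M' = B * M`. Taking the columns in `J` gives `1 = B * M_J`, so `B` must be `M_J⁻¹`. -/
theorem eq_normalize_of_span_row_eq (hM' : M'.submatrix id J = 1)
    (h : Submodule.span F (Set.range M.row) = Submodule.span F (Set.range M'.row)) :
    IsUnit (M.submatrix id J).det ∧ M' = normalize J M := by
  obtain ⟨B, hB⟩ := exists_eq_mul_of_range_subset (M := M) (M' := M')
    (h ▸ Submodule.subset_span)
  have h1 : B * M.submatrix id J = 1 := by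
    rw [← hM', hB]
    rfl
  refine ⟨Matrix.isUnit_det_of_left_inverse h1, ?_⟩
  rw [normalize, Matrix.inv_eq_left_inv h1, hB]

/-- Row rank equals column rank, so some `d` columns are independent; sorting them gives `I`. -/
theorem exists_isUnit_det_submatrix (hM : LinearIndependent F M.row) :
    ∃ I : Fin d ↪o Fin m, IsUnit (M.submatrix id I).det := by
  have hrank : Module.finrank F (Submodule.span F (Set.range M.col)) = d := by
    rw [← Matrix.rank_eq_finrank_span_cols]
    simpa using hM.rank_matrix
  have hf := Submodule.exists_fun_fin_finrank_span_eq F (Set.range M.col)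
  rw [hrank] at hf
  obtain ⟨f, hf, -, hli⟩ := hf
  choose h hh using hf
  obtain rfl : f = fun a => M.col (h a) := funext fun a => (hh a).symm
  have hinj : Function.Injective h := fun a b hab => hli.injective (by simp [hab])
  obtain ⟨I, σ, rfl⟩ := exists_orderEmbedding_comp_perm hinj
  refine ⟨I, ?_⟩
  have h1 : LinearIndependent F (M.submatrix id I).col := by
    have h2 := hli.comp σ.symm σ.symm.injective
    simp only [Function.comp_def, Equiv.apply_symm_apply] at h2
    exact h2
  exact (Matrix.isUnit_iff_isUnit_det _).1 (Matrix.linearIndependent_cols_iff_isUnit.1 h1)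

theorem exists_matrix_of_finrank_eq {N : Submodule F (Fin m → F)} (hN : Module.finrank F N = d) :
    ∃ (I : Fin d ↪o Fin m) (M : Matrix (Fin d) (Fin m) F), M.submatrix id I = 1 ∧
      Submodule.span F (Set.range M.row) = N := by
  let b := Module.finBasisOfFinrankEq F N hN
  let M : Matrix (Fin d) (Fin m) F := Matrix.of fun a => (b a : Fin m → F)
  have hspan : Submodule.span F (Set.range M.row) = N := by
    have h := congrArg (Submodule.map N.subtype) b.span_eq
    rw [Submodule.map_span, ← Set.range_comp, Submodule.map_top, Submodule.range_subtype] at h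
    exact h
  have hli : LinearIndependent F M.row :=
    b.linearIndependent.map' N.subtype N.ker_subtype
  obtain ⟨I, hI⟩ := exists_isUnit_det_submatrix hli
  exact ⟨I, normalize I M, normalize_submatrix hI, (span_row_normalize hI).trans hspan⟩

end LinearAlgebra

/-! ### `F`-points of the charts and of the overlaps. -/

theorem chartPoint_left (I : Fin d ↪o Fin m) (M : Matrix (Fin d) (Fin m) F)
    (hM : M.submatrix id I = 1) : (chartPoint I M hM).left =
      Spec.map (CommRingCat.ofHom (chartLift F I M hM).toRingHom) := rfl

/-- An `F`-point of an affine `F`-scheme is given by an algebra homomorphism. -/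
theorem exists_algHom_of_point {A : Type u} [CommRing A] [Algebra F A]
    (p : FPoints (specOver F A)) :
    ∃ φ : A →ₐ[F] F, p.left = Spec.map (CommRingCat.ofHom φ.toRingHom) := by
  obtain ⟨f, hf⟩ := Spec.map_surjective (show Spec (CommRingCat.of F) ⟶ Spec (CommRingCat.of A)
    from p.left)
  have h := Over.w p
  have h1 : Spec.map f ≫ Spec.map (CommRingCat.ofHom (algebraMap F A)) =
      𝟙 (Spec (CommRingCat.of F)) := by
    rw [hf]
    exact h
  rw [← Spec.map_comp, ← Spec.map_id] at h1
  have h2 := Spec.map_injective h1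
  refine ⟨⟨f.hom, fun c => ?_⟩, hf.symm⟩
  exact congrArg (fun g : CommRingCat.of F ⟶ CommRingCat.of F => g.hom c) h2

theorem algHom_ext_chartMatrix {I : Fin d ↪o Fin m} {T : Type u} [CommRing T] [Algebra F T]
    {φ φ' : ChartRing F I →ₐ[F] T} (h : (chartMatrix F I).map φ = (chartMatrix F I).map φ') :
    φ = φ' := by
  refine Ideal.Quotient.algHom_ext _ (MvPolynomial.algHom_ext fun p => ?_)
  exact congrFun (congrFun h p.1) p.2

theorem exists_eq_chartPoint {I : Fin d ↪o Fin m} (p : FPoints (chart F I)) :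
    ∃ (M : Matrix (Fin d) (Fin m) F) (hM : M.submatrix id I = 1), p = chartPoint I M hM := by
  obtain ⟨φ, hφ⟩ := exists_algHom_of_point p
  have hM : ((chartMatrix F I).map φ).submatrix id I = 1 := by
    have h := congrArg (fun A => Matrix.map A φ) (chartMatrix_submatrix F I)
    simp only [Matrix.map_one _ (map_zero _) (map_one _)] at h
    exact h
  refine ⟨(chartMatrix F I).map φ, hM, ?_⟩
  ext : 1
  rw [chartPoint_left, hφ,
    algHom_ext_chartMatrix (φ' := φ) (chartLift_chartMatrix F I ((chartMatrix F I).map φ) hM)]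

theorem chartPoint_injective {I : Fin d ↪o Fin m} {M M' : Matrix (Fin d) (Fin m) F}
    {hM : M.submatrix id I = 1} {hM' : M'.submatrix id I = 1}
    (h : chartPoint I M hM = chartPoint I M' hM') : M = M' := by
  have h1 := congrArg (fun p => p.left) h
  simp only [chartPoint_left] at h1
  have h2 : (chartLift F I M hM).toRingHom = (chartLift F I M' hM').toRingHom :=
    congrArg CommRingCat.Hom.hom (Spec.map_injective h1)
  rw [← chartLift_chartMatrix F I M hM, ← chartLift_chartMatrix F I M' hM']
  ext a j
  exact RingHom.congr_fun h2 (chartMatrix F I a j)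

/-- The image of the overlap matrix under an extension of the homomorphism given by `M` is `M`. -/
theorem overlapMatrix_map {I J : Fin d ↪o Fin m} {M : Matrix (Fin d) (Fin m) F}
    {hM : M.submatrix id I = 1} {φ : OverlapRing F I J →ₐ[F] F}
    (hφ : φ.comp (IsScalarTower.toAlgHom F (ChartRing F I) (OverlapRing F I J)) =
      chartLift F I M hM) : (overlapMatrix F I J).map φ = M := by
  have h := chartLift_chartMatrix F I M hM
  rw [← hφ] at h
  exact h

theorem isUnit_det_of_overlap {I J : Fin d ↪o Fin m} {M : Matrix (Fin d) (Fin m) F}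
    {hM : M.submatrix id I = 1} {φ : OverlapRing F I J →ₐ[F] F}
    (hφ : φ.comp (IsScalarTower.toAlgHom F (ChartRing F I) (OverlapRing F I J)) =
      chartLift F I M hM) : IsUnit (M.submatrix id J).det := by
  have h := (isUnit_det_overlapMatrix F I J).map φ
  rw [AlgHom.map_det] at h
  rw [← overlapMatrix_map hφ]
  exact h

theorem transMatrix_map {I J : Fin d ↪o Fin m} {M : Matrix (Fin d) (Fin m) F}
    {hM : M.submatrix id I = 1} {φ : OverlapRing F I J →ₐ[F] F}
    (hφ : φ.comp (IsScalarTower.toAlgHom F (ChartRing F I) (OverlapRing F I J)) =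
      chartLift F I M hM) : (transMatrix F I J).map φ = normalize J M := by
  have hu := isUnit_det_of_overlap hφ
  -- Rather than moving the inverse through `φ`, apply `φ` to `x_J * (x_J⁻¹ x) = x` and cancel
  -- `M_J`.
  have h1 : (overlapMatrix F I J).submatrix id J * transMatrix F I J = overlapMatrix F I J := by
    rw [transMatrix, ← Matrix.mul_assoc, Matrix.mul_nonsing_inv _ (isUnit_det_overlapMatrix F I J),
      Matrix.one_mul]
  have h2 := congrArg (fun A => Matrix.map A φ) h1
  simp only [Matrix.map_mul, overlapMatrix_map hφ] at h2
  have h3 : ((overlapMatrix F I J).submatrix id J).map φ = M.submatrix id J :=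
    congrArg (fun A => Matrix.submatrix A id J) (overlapMatrix_map hφ)
  rw [h3] at h2
  calc (transMatrix F I J).map φ
      = (M.submatrix id J)⁻¹ * (M.submatrix id J * (transMatrix F I J).map φ) := by
        rw [← Matrix.mul_assoc, Matrix.nonsing_inv_mul _ hu, Matrix.one_mul]
    _ = normalize J M := by rw [h2, normalize]

theorem exists_overlap_algHom {I J : Fin d ↪o Fin m} {M : Matrix (Fin d) (Fin m) F}
    (hM : M.submatrix id I = 1) (hJ : IsUnit (M.submatrix id J).det) :
    ∃ φ : OverlapRing F I J →ₐ[F] F,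
      φ.comp (IsScalarTower.toAlgHom F (ChartRing F I) (OverlapRing F I J)) =
        chartLift F I M hM := by
  have h : IsUnit (chartLift F I M hM ((chartMatrix F I).submatrix id J).det) := by
    rw [AlgHom.map_det]
    have e : (chartLift F I M hM).mapMatrix ((chartMatrix F I).submatrix id J) =
        M.submatrix id J :=
      congrArg (fun A => Matrix.submatrix A id J) (chartLift_chartMatrix F I M hM)
    rwa [e]
  have h' : ∀ y : Submonoid.powers ((chartMatrix F I).submatrix id J).det,
      IsUnit (chartLift F I M hM y) := by
    rintro ⟨_, k, rfl⟩
    simpa using h.pow k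
  refine ⟨IsLocalization.liftAlgHom (f := chartLift F I M hM) h', AlgHom.ext fun z => ?_⟩
  exact IsLocalization.lift_eq (S := OverlapRing F I J) h' z

/-- The `F`-point of an affine scheme given by an algebra homomorphism. -/
noncomputable def pointOfAlgHom {A : Type u} [CommRing A] [Algebra F A] (φ : A →ₐ[F] F) :
    FPoints (specOver F A) :=
  Over.homMk (Spec.map (CommRingCat.ofHom φ.toRingHom)) (by
    simp only [specOver, specBase, Over.mk_hom, ← Spec.map_comp, ← CommRingCat.ofHom_comp]
    rw [← Spec.map_id]
    congr 1
    ext x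
    exact φ.commutes x)

theorem pointOfAlgHom_comp {A B : Type u} [CommRing A] [Algebra F A] [CommRing B] [Algebra F B]
    (φ : B →ₐ[F] F) (f : A →ₐ[F] B) :
    pointOfAlgHom φ ≫ specOverMap f = pointOfAlgHom (φ.comp f) := by
  ext : 1
  exact (Spec.map_comp _ _).symm

/-! ### `F`-points of an arbitrary gluing of the charts. -/

section Gluing

variable {G : Over (Spec (CommRingCat.of F))} {ψ : ∀ I : Fin d ↪o Fin m, chart F I ⟶ G}

theorem overlap_point_comp {I J : Fin d ↪o Fin m} {M : Matrix (Fin d) (Fin m) F}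
    {hM : M.submatrix id I = 1} {φ : OverlapRing F I J →ₐ[F] F}
    (hφ : φ.comp (IsScalarTower.toAlgHom F (ChartRing F I) (OverlapRing F I J)) =
      chartLift F I M hM) :
    (show FPoints (overlap F I J) from pointOfAlgHom φ) ≫ overlapInc F I J = chartPoint I M hM := by
  refine (pointOfAlgHom_comp _ _).trans ?_
  rw [hφ]
  rfl

theorem overlap_point_transition {I J : Fin d ↪o Fin m} {M : Matrix (Fin d) (Fin m) F}
    {hM : M.submatrix id I = 1} {φ : OverlapRing F I J →ₐ[F] F}
    (hφ : φ.comp (IsScalarTower.toAlgHom F (ChartRing F I) (OverlapRing F I J)) =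
      chartLift F I M hM) :
    (show FPoints (overlap F I J) from pointOfAlgHom φ) ≫ transition F I J ≫ overlapInc F J I =
      chartPoint J (normalize J M) (normalize_submatrix (isUnit_det_of_overlap hφ)) := by
  rw [transition_overlapInc]
  refine (pointOfAlgHom_comp _ _).trans ?_
  have h : φ.comp (chartLift F J (transMatrix F I J) (transMatrix_submatrix_self F I J)) =
      chartLift F J (normalize J M) (normalize_submatrix (isUnit_det_of_overlap hφ)) := by
    apply algHom_ext_chartMatrix
    rw [chartLift_chartMatrix, ← transMatrix_map hφ]
    exact congrArg (fun A => Matrix.map A φ)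
      (chartLift_chartMatrix F J (transMatrix F I J) (transMatrix_submatrix_self F I J))
  rw [h]
  rfl

variable (H : IsGluing (overlapInc F) (transition F) ψ)

include H

/-- If `M_J` is invertible, `M` lifts to an `F`-point of the overlap; evaluate the gluing
compatibility there. -/
theorem chartPoint_normalize_comp {I J : Fin d ↪o Fin m} {M : Matrix (Fin d) (Fin m) F}
    (hM : M.submatrix id I = 1) (hJ : IsUnit (M.submatrix id J).det) :
    chartPoint J (normalize J M) (normalize_submatrix hJ) ≫ ψ J = chartPoint I M hM ≫ ψ I := by
  obtain ⟨φ, hφ⟩ := exists_overlap_algHom hM hJ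
  rw [← overlap_point_comp hφ, ← overlap_point_transition hφ]
  have h := congrArg (fun g => (show FPoints (overlap F I J) from pointOfAlgHom φ) ≫ g)
    (H.compat I J)
  exact (Category.assoc _ _ _).trans
    ((congrArg (_ ≫ ·) (Category.assoc _ _ _)).trans (h.trans (Category.assoc _ _ _).symm))

/-- The common image lies in both charts, hence in `ψ_I(𝒲(I,J))`. Injectivity of `ψ_I` then puts the
point of `𝒲(I)` in the locus where `det x_J` does not vanish. -/
theorem isUnit_det_of_comp_eq {I J : Fin d ↪o Fin m} {M M' : Matrix (Fin d) (Fin m) F}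
    {hM : M.submatrix id I = 1} {hM' : M'.submatrix id J = 1}
    (h : chartPoint I M hM ≫ ψ I = chartPoint J M' hM' ≫ ψ J) :
    IsUnit (M.submatrix id J).det := by
  have hI := H.isOpenImmersion I
  let x : Spec (CommRingCat.of F) := (⊥ : PrimeSpectrum F)
  have hx : (ψ I).left ((chartPoint I M hM).left x) = (ψ J).left ((chartPoint J M' hM').left x) := by
    have h1 := congrArg (fun p => p.left x) h
    exact (Scheme.Hom.comp_apply _ _ _).symm.trans (h1.trans (Scheme.Hom.comp_apply _ _ _))
  have h1 : (ψ I).left ((chartPoint I M hM).left x) ∈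
      Set.range (ψ I).left ∩ Set.range (ψ J).left := ⟨⟨_, rfl⟩, ⟨_, hx.symm⟩⟩
  rw [H.inter_left] at h1
  obtain ⟨w, hw⟩ := h1
  have h2 : (overlapInc F I J).left w = (chartPoint I M hM).left x :=
    (ψ I).left.isOpenEmbedding.injective ((Scheme.Hom.comp_apply _ _ _).symm.trans hw)
  have h3 : (chartPoint I M hM).left x ∈ Set.range (overlapInc F I J).left := ⟨w, h2⟩
  rw [range_overlapInc] at h3
  rw [isUnit_iff_ne_zero]
  intro h0
  apply h3
  change chartLift F I M hM ((chartMatrix F I).submatrix id J).det ∈ (⊥ : PrimeSpectrum F).asIdeal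
  rw [AlgHom.map_det]
  have e : (chartLift F I M hM).mapMatrix ((chartMatrix F I).submatrix id J) = M.submatrix id J :=
    congrArg (fun A => Matrix.submatrix A id J) (chartLift_chartMatrix F I M hM)
  rw [e, h0]
  exact Ideal.zero_mem _

theorem eq_normalize_of_comp_eq {I J : Fin d ↪o Fin m} {M M' : Matrix (Fin d) (Fin m) F}
    {hM : M.submatrix id I = 1} {hM' : M'.submatrix id J = 1}
    (h : chartPoint I M hM ≫ ψ I = chartPoint J M' hM' ≫ ψ J) :
    IsUnit (M.submatrix id J).det ∧ M' = normalize J M := by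
  have hJ : IsUnit (M.submatrix id J).det := isUnit_det_of_comp_eq H h
  refine ⟨hJ, ?_⟩
  have hmono : Mono (ψ J) := by
    have := H.isOpenImmersion J
    exact (Over.forget _).mono_of_mono_map (inferInstanceAs (Mono (ψ J).left))
  rw [← chartPoint_normalize_comp H hM hJ] at h
  exact (chartPoint_injective ((cancel_mono (ψ J)).1 h)).symm

/-- As `Spec F` is a single point, its image lies in one chart, and the morphism lifts along that
open immersion. -/
theorem exists_eq_chartPoint_comp (p : FPoints G) :
    ∃ (I : Fin d ↪o Fin m) (M : Matrix (Fin d) (Fin m) F) (hM : M.submatrix id I = 1),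
      p = chartPoint I M hM ≫ ψ I := by
  let x : Spec (CommRingCat.of F) := (⊥ : PrimeSpectrum F)
  obtain ⟨I, hI⟩ := Set.mem_iUnion.1 (H.cover ▸ Set.mem_univ (p.left x))
  have := H.isOpenImmersion I
  have hr : Set.range p.left ⊆ Set.range (ψ I).left := by
    rintro _ ⟨y, rfl⟩
    have hy : y = x := Subsingleton.elim (α := PrimeSpectrum F) y x
    rwa [hy]
  let q : FPoints (chart F I) := Over.homMk (IsOpenImmersion.lift (ψ I).left p.left hr) (by
    rw [← Over.w (ψ I), ← Category.assoc, IsOpenImmersion.lift_fac, Over.w p])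
  have hq : q ≫ ψ I = p := by
    ext : 1
    exact IsOpenImmersion.lift_fac _ _ _
  obtain ⟨M, hM, hqM⟩ := exists_eq_chartPoint q
  exact ⟨I, M, hM, by rw [← hqM, hq]⟩

theorem exists_pointsEquiv : ∃ e : FPoints G ≃ SubspaceGrassmannian F d m,
    ∀ (I : Fin d ↪o Fin m) (M : Matrix (Fin d) (Fin m) F) (hM : M.submatrix id I = 1),
      (e (chartPoint I M hM ≫ ψ I) : Submodule F (Fin m → F)) =
        Submodule.span F (Set.range M.row) := by
  -- A chart and a matrix are chosen for each point; `key` shows that the row space does not depend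
  -- on the choice.
  choose I M hM hp using exists_eq_chartPoint_comp H
  have key : ∀ (J : Fin d ↪o Fin m) (M' : Matrix (Fin d) (Fin m) F) (hM' : M'.submatrix id J = 1),
      Submodule.span F (Set.range (M (chartPoint J M' hM' ≫ ψ J)).row) =
        Submodule.span F (Set.range M'.row) := by
    intro J M' hM'
    obtain ⟨h1, h2⟩ := eq_normalize_of_comp_eq H (hp (chartPoint J M' hM' ≫ ψ J))
    rw [h2, span_row_normalize h1]
  let f : FPoints G → SubspaceGrassmannian F d m := fun p =>
    ⟨Submodule.span F (Set.range (M p).row), finrank_span_row (hM p)⟩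
  have hf : Function.Bijective f := by
    constructor
    · intro p q hpq
      obtain ⟨h1, h2⟩ := eq_normalize_of_span_row_eq (hM q) (congrArg Subtype.val hpq)
      rw [hp p, hp q, ← chartPoint_normalize_comp H (hM p) h1]
      congr 2
      exact h2.symm
    · rintro ⟨N, hN⟩
      obtain ⟨J, M', hM', rfl⟩ := exists_matrix_of_finrank_eq hN
      exact ⟨chartPoint J M' hM' ≫ ψ J, Subtype.ext (key J M' hM')⟩
  exact ⟨Equiv.ofBijective f hf, key⟩

end Gluing

end Grass

/-! ### The case without charts, and the conclusion. -/

namespace Grass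

variable (F : Type u) [Field F] (d m : ℕ)

/-- The empty `F`-scheme. -/
noncomputable def emptyOver : Over (Spec (CommRingCat.of F)) :=
  Over.mk (Scheme.emptyTo (Spec (CommRingCat.of F)))

instance isEmpty_emptyOver : IsEmpty (emptyOver F).left :=
  inferInstanceAs (IsEmpty (∅ : Scheme.{u}))

theorem isProjectiveScheme_emptyOver : IsProjectiveScheme (emptyOver F) :=
  ⟨0, Over.homMk (Scheme.emptyTo _) (Scheme.empty_ext _ _), inferInstance⟩

theorem isGluing_emptyOver [IsEmpty (Fin d ↪o Fin m)] :
    IsGluing (overlapInc F) (transition F)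
      (fun I : Fin d ↪o Fin m => (isEmptyElim I : chart F I ⟶ emptyOver F)) where
  isOpenImmersion I := isEmptyElim I
  compat I := isEmptyElim I
  cover := Set.eq_univ_of_forall fun x => isEmptyElim (α := (emptyOver F).left) x
  inter_left I := isEmptyElim I
  inter_right I := isEmptyElim I

theorem exists_isGluing : ∃ (G : Over (Spec (CommRingCat.of F)))
    (ψ : ∀ I : Fin d ↪o Fin m, chart F I ⟶ G),
      IsGluing (overlapInc F) (transition F) ψ ∧ IsProjectiveScheme G := by
  rcases isEmpty_or_nonempty (Fin d ↪o Fin m) with h | h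
  · exact ⟨emptyOver F, _, isGluing_emptyOver F d m, isProjectiveScheme_emptyOver F⟩
  -- Since `ℙⁿ` has `n + 1` coordinates, the number of minors must be positive, so the case without
  -- charts is treated separately.
  · obtain ⟨n, hn⟩ := Nat.exists_eq_succ_of_ne_zero (Fintype.card_ne_zero (α := Fin d ↪o Fin m))
    let e := Fintype.equivFinOfCardEq hn
    exact ⟨grassmannScheme F e, grassmannChart F e, isGluing_grassmannChart F e,
      isProjectiveScheme_grassmannScheme F e⟩

end Grass

theorem mainTheorem8 (F : Type u) [Field F] (d m : ℕ) :
    ∃ (G : Over (Spec (CommRingCat.of F)))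
      (ψ : ∀ I : Fin d ↪o Fin m, Grass.chart F I ⟶ G),
      IsGluing (Grass.overlapInc F) (Grass.transition F) ψ ∧
      IsProjectiveScheme G ∧
      (∃ e : FPoints G ≃ SubspaceGrassmannian F d m,
        ∀ (I : Fin d ↪o Fin m) (M : Matrix (Fin d) (Fin m) F) (hM : M.submatrix id I = 1),
          (e (Grass.chartPoint I M hM ≫ ψ I) : Submodule F (Fin m → F)) =
            Submodule.span F (Set.range M.row)) ∧
      (m < d → IsEmpty G.left) := by
  obtain ⟨G, ψ, H, hG⟩ := Grass.exists_isGluing F d m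
  refine ⟨G, ψ, H, hG, Grass.exists_pointsEquiv H, fun hlt => ⟨fun x => ?_⟩⟩
  obtain ⟨I, -⟩ := Set.mem_iUnion.1 (H.cover ▸ Set.mem_univ x)
  have h := Fintype.card_le_of_injective I I.injective
  simp only [Fintype.card_fin] at h
  omega
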